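/- Let $d\ge 1$ and let $J\subset\mathbb{R}^d$ be a compact set with non-empty interior; write $|A|$ for the diameter of $A$. Let $(c_k)_{k\ge1}$ and $(a_k)_{k\ge1}$ be real sequences and $(n_k)_{k\ge1}$ a sequence of integers with $n_k\ge2$, $0<c_k<1$, $a_k\ge0$ for all $k\ge1$, $\inf_k c_k>0$ and $\sum_k a_k<\infty$. Let $\Omega_k=\{\sigma_1\cdots\sigma_k: 1\le\sigma_j\le n_j\}$ be the set of words of length $k$, with $\Omega_0=\{\emptyset\}$, and write $\sigma*j$ for the word $\sigma$ followed by the letter $j$. A set $E\subset\mathbb{R}^d$ belongs to the class $\mathcal{C}(J,\{c_k\},\{n_k\},\{a_k\})$ of Cantor-like sets if $$E=\bigcap_{k\ge1}\ \bigcup_{\sigma\in\Omega_k}J_\sigma$$ for some sets $J_\sigma\subset\mathbb{R}^d$ ($\sigma\in\bigcup_{k\ge0}\Omega_k$) such that $J_\emptyset=J$ and, for all $k\ge1$, $\sigma\in\Omega_{k-1}$ and $1\le j\le n_k$: the set $J_{\sigma*j}$ is contained in $J_\sigma$ and geometrically similar to $J_\sigma$ (that is, it is the image of $J_\sigma$ under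 a bijection of $\mathbb{R}^d$ that multiplies all distances by a positive constant), $$c_k(1-a_k)\le\frac{|J_{\sigma*j}|}{|J_\sigma|}\le c_k(1+a_k),$$ and the interiors of $J_{\sigma*i}$ and $J_{\sigma*j}$ are disjoint for all $1\le i<j\le n_k$. For $0<\theta<1$ and $F\subset\mathbb{R}^d$, the Assouad spectrum $\dim_A^\theta F$ is the infimum of all $s\ge0$ for which there are $b,C>0$ such that $$N_{R^{1/\theta}}\big(B(x,R)\cap F\big)\le C\left(\frac{R}{R^{1/\theta}}\right)^{s}\qquad\text{for all }0<R<b\text{ and }x\in F,$$ where $B(x,R)$ is the closed ball with centre $x$ and radius $R$, and $N_r(A)$ is the smallest number of closed balls of radius $r$ in $\mathbb{R}^d$ that cover $A$. Put $\delta_k=c_1c_2\cdots c_k$. Then for every $E\in\mathcal{C}(J,\{c_k\},\{n_k\},\{a_k\})$ and every $0<\theta<1$, the maximum $$l(\theta,k)=\max\{l\in\mathbb{Z},\ l\ge1:\ \delta_l\ge\delta_k^{1/\theta}\}$$ exists for every $k\ge1$, and $$\dim_A^\theta E=\limsup_{k\to\infty}\frac{\log\big(n_{k+1}n_{k+2}\cdots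 n_{l(\theta,k)}\big)}{\left(1-\frac1\theta\right)\log\delta_k},$$ where the empty product (the case $l(\theta,k)=k$) equals $1$. -/

import Mathlib

open scoped NNReal ENNReal

noncomputable section

namespace CantorLike

/-- The Assouad spectrum of a subset `F` of a metric space at the parameter `θ`: the infimum of the
exponents `s ≥ 0` for which there are `b, C > 0` such that, for all `0 < R < b` and `x ∈ F`, the set
`B(x, R) ∩ F` can be covered by at most `C (R / R ^ (1 / θ)) ^ s` balls of radius `R ^ (1 / θ)`
(centred anywhere in the space). The infimum is taken in the extended reals, so that it would be
`⊤` if there were no such exponent. -/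
def assouadSpectrum {X : Type*} [MetricSpace X] (θ : ℝ) (F : Set X) : EReal :=
  sInf (Real.toEReal '' {s : ℝ | 0 ≤ s ∧ ∃ b C : ℝ, 0 < b ∧ 0 < C ∧
    ∀ R : ℝ, 0 < R → R < b → ∀ x ∈ F,
      ((Metric.externalCoveringNumber (R ^ (1 / θ)).toNNReal
          (Metric.closedBall x R ∩ F) : ℕ∞) : ℝ≥0∞)
        ≤ ENNReal.ofReal (C * (R / R ^ (1 / θ)) ^ s)})

/-- `B` is geometrically similar to `A`: it is the image of `A` under a bijection of the space which
multiplies all distances by one positive constant. -/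
def GeometricallySimilar {X : Type*} [MetricSpace X] (A B : Set X) : Prop :=
  ∃ f : X ≃ᵈ X, f '' A = B

/-- The conditions on the three sequences `c_k, n_k, a_k` (`k ≥ 1`) of a Cantor-like set; the values
at the index `0` are irrelevant. -/
structure IsAdmissible (c : ℕ → ℝ) (n : ℕ → ℕ) (a : ℕ → ℝ) : Prop where
  two_le : ∀ k, 1 ≤ k → 2 ≤ n k
  c_pos : ∀ k, 1 ≤ k → 0 < c k
  c_lt_one : ∀ k, 1 ≤ k → c k < 1
  c_inf_pos : 0 < ⨅ k : ℕ, c (k + 1)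
  a_nonneg : ∀ k, 1 ≤ k → 0 ≤ a k
  a_summable : Summable fun k : ℕ => a (k + 1)

/-- The set `Ω_k` of words `σ_1 ⋯ σ_k` of length `k`, whose `j`-th letter ranges over an alphabet
with `n_j` elements. -/
abbrev Word (n : ℕ → ℕ) (k : ℕ) : Type :=
  (i : Fin k) → Fin (n ((i : ℕ) + 1))

/-- The word `σ * j` obtained from `σ ∈ Ω_k` by appending the letter `j`. -/
def Word.append {n : ℕ → ℕ} {k : ℕ} (σ : Word n k) (j : Fin (n (k + 1))) : Word n (k + 1) :=
  Fin.snoc (α := fun i : Fin (k + 1) => Fin (n ((i : ℕ) + 1))) σ j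

/-- `B k σ` (for `σ ∈ Ω_k`) is a family of basic sets `J_σ` defining a Cantor-like set: `J` is the
basic set of the empty word, and the children of a basic set of level `k` are subsets similar to it,
with ratios of diameters between `c_{k+1} (1 - a_{k+1})` and `c_{k+1} (1 + a_{k+1})` and with
pairwise disjoint interiors. -/
structure IsBasicFamily {d : ℕ} (J : Set (EuclideanSpace ℝ (Fin d)))
    (c : ℕ → ℝ) (n : ℕ → ℕ) (a : ℕ → ℝ)
    (B : (k : ℕ) → Word n k → Set (EuclideanSpace ℝ (Fin d))) : Prop where
  root : ∀ σ : Word n 0, B 0 σ = J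
  subset : ∀ (k : ℕ) (σ : Word n k) (j : Fin (n (k + 1))), B (k + 1) (σ.append j) ⊆ B k σ
  similar : ∀ (k : ℕ) (σ : Word n k) (j : Fin (n (k + 1))),
    GeometricallySimilar (B k σ) (B (k + 1) (σ.append j))
  le_ratio : ∀ (k : ℕ) (σ : Word n k) (j : Fin (n (k + 1))),
    c (k + 1) * (1 - a (k + 1)) ≤ Metric.diam (B (k + 1) (σ.append j)) / Metric.diam (B k σ)
  ratio_le : ∀ (k : ℕ) (σ : Word n k) (j : Fin (n (k + 1))),
    Metric.diam (B (k + 1) (σ.append j)) / Metric.diam (B k σ) ≤ c (k + 1) * (1 + a (k + 1))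
  disjoint : ∀ (k : ℕ) (σ : Word n k) (i j : Fin (n (k + 1))), i ≠ j →
    Disjoint (interior (B (k + 1) (σ.append i))) (interior (B (k + 1) (σ.append j)))

/-- The class `𝒞(J, {c_k}, {n_k}, {a_k})` of Cantor-like sets: all sets `⋂_{k ≥ 1} ⋃_{σ ∈ Ω_k} J_σ`
for the families of basic sets `J_σ` as above. -/
def cantorLikeSets {d : ℕ} (J : Set (EuclideanSpace ℝ (Fin d)))
    (c : ℕ → ℝ) (n : ℕ → ℕ) (a : ℕ → ℝ) : Set (Set (EuclideanSpace ℝ (Fin d))) :=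
  {E | ∃ B : (k : ℕ) → Word n k → Set (EuclideanSpace ℝ (Fin d)),
    IsBasicFamily J c n a B ∧ E = ⋂ (k : ℕ) (_ : 1 ≤ k), ⋃ σ : Word n k, B k σ}

/-- `δ_k = c_1 ⋯ c_k`. -/
def delta (c : ℕ → ℝ) (k : ℕ) : ℝ :=
  ∏ i ∈ Finset.Icc 1 k, c i

/-- The set of the integers `l ≥ 1` with `δ_l ≥ δ_k ^ (1 / θ)`. -/
def levelSet (c : ℕ → ℝ) (θ : ℝ) (k : ℕ) : Set ℕ :=
  {l | 1 ≤ l ∧ delta c k ^ (1 / θ) ≤ delta c l}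

/-- `l(θ, k) = max {l ≥ 1 : δ_l ≥ δ_k ^ (1 / θ)}`. -/
def level (c : ℕ → ℝ) (θ : ℝ) (k : ℕ) : ℕ :=
  sSup (levelSet c θ k)

end CantorLike

end

/-! All basic sets of level `k` have diameter comparable to `δ_k`: the ratio errors multiply to a
bounded factor because `∑ a_k` converges. By similarity each contains a ball of radius comparable to
`δ_k`, and these balls are disjoint, so by volume a ball of radius `≲ δ_k` meets boundedly many sets
of level `k` (`exists_card_le`). Hence, for `R ≈ δ_k` and `r ≈ δ_l`, covering `B(x, R) ∩ E` by
`r`-balls costs `n_{k+1} ⋯ n_l` up to constants: from above for every centre (`exists_covering_le`),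
from below for centres in a basic set of diameter at most `R` (`exists_le_covering`).

For `r = R ^ (1 / θ)` the matching level is `l(θ, k)`; `inf c_k > 0` lets an arbitrary small `R` be
replaced by some `δ_k`. Taking logarithms gives the formula, since constants vanish against `(1 - 1
/ θ) log δ_k → ∞`. -/

namespace CantorLike

/-! ### Words and their extensions -/

namespace Word

variable {n : ℕ → ℕ} {k : ℕ}

theorem append_inj {σ τ : Word n k} {i j : Fin (n (k + 1))} (h : σ.append i = τ.append j) :
    σ = τ ∧ i = j :=
  Fin.snoc_injective2 (α := fun i : Fin (k + 1) => Fin (n ((i : ℕ) + 1))) h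

theorem exists_append_eq (τ : Word n (k + 1)) :
    ∃ (σ : Word n k) (j : Fin (n (k + 1))), σ.append j = τ :=
  ⟨Fin.init (α := fun i : Fin (k + 1) => Fin (n ((i : ℕ) + 1))) τ, τ (Fin.last k),
    Fin.snoc_init_self (α := fun i : Fin (k + 1) => Fin (n ((i : ℕ) + 1))) τ⟩

/-- The words of length `k + m` which extend a word of length `k`. -/
def descendants (σ : Word n k) : (m : ℕ) → Finset (Word n (k + m))
  | 0 => {σ}
  | m + 1 => (descendants σ m ×ˢ (Finset.univ : Finset (Fin (n (k + m + 1))))).image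
      fun p => p.1.append p.2

theorem append_mem_descendants {σ : Word n k} {m : ℕ} {τ : Word n (k + m)}
    (h : τ ∈ σ.descendants m) (j : Fin (n (k + m + 1))) :
    (τ.append j : Word n (k + m + 1)) ∈ σ.descendants (m + 1) :=
  Finset.mem_image.2 ⟨(τ, j), by simp [h], rfl⟩

theorem card_descendants (σ : Word n k) (m : ℕ) :
    (σ.descendants m).card = ∏ i ∈ Finset.Icc (k + 1) (k + m), n i := by
  induction m with
  | zero => simp [descendants]
  | succ m ih =>
    rw [descendants, Finset.card_image_of_injective, Finset.card_product, ih, ← add_assoc,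
      Finset.prod_Icc_succ_top (by omega)]
    · simp
    · intro p q h
      obtain ⟨h1, h2⟩ := append_inj h
      exact Prod.ext h1 h2

theorem exists_mem_descendants (k m : ℕ) (τ : Word n (k + m)) :
    ∃ σ : Word n k, τ ∈ σ.descendants m := by
  induction m with
  | zero => exact ⟨τ, by simp [descendants]⟩
  | succ m ih =>
    obtain ⟨τ', j, rfl⟩ := exists_append_eq (k := k + m) τ
    obtain ⟨σ, hσ⟩ := ih τ'
    exact ⟨σ, append_mem_descendants hσ j⟩

end Word

/-! ### The scales `δ_k` -/

theorem delta_zero (c : ℕ → ℝ) : delta c 0 = 1 := by simp [delta]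

theorem delta_succ (c : ℕ → ℝ) (k : ℕ) : delta c (k + 1) = delta c k * c (k + 1) := by
  simp [delta, Finset.prod_Icc_succ_top]

namespace IsAdmissible

variable {c : ℕ → ℝ} {n : ℕ → ℕ} {a : ℕ → ℝ} (h : IsAdmissible c n a)
include h

theorem delta_pos (k : ℕ) : 0 < delta c k :=
  Finset.prod_pos fun i hi => h.c_pos i (Finset.mem_Icc.1 hi).1

theorem delta_antitone : Antitone (delta c) :=
  antitone_nat_of_succ_le fun k => by
    rw [delta_succ]
    exact mul_le_of_le_one_right (h.delta_pos k).le (h.c_lt_one _ (by omega)).le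

theorem delta_lt_one {k : ℕ} (hk : 1 ≤ k) : delta c k < 1 :=
  (h.delta_antitone hk).trans_lt <| by
    rw [delta_succ, delta_zero, one_mul]; exact h.c_lt_one 1 le_rfl

theorem delta_le_one (k : ℕ) : delta c k ≤ 1 :=
  (h.delta_antitone (Nat.zero_le k)).trans_eq (delta_zero c)

theorem iInf_mul_delta_le (k : ℕ) : (⨅ k : ℕ, c (k + 1)) * delta c k ≤ delta c (k + 1) := by
  rw [delta_succ, mul_comm]
  refine mul_le_mul_of_nonneg_left (ciInf_le ⟨0, ?_⟩ k) (h.delta_pos k).le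
  rintro _ ⟨i, rfl⟩
  exact (h.c_pos _ (by omega)).le

theorem word_nonempty (k : ℕ) : Nonempty (Word n k) :=
  ⟨fun i => ⟨0, by have := h.two_le (i + 1) (by omega); omega⟩⟩

end IsAdmissible

/-- Finitely many disjoint balls of radius `r` in a ball of radius `R` number at most
`(R / r) ^ d`. -/
theorem card_mul_pow_le_of_disjoint_balls {d : ℕ} (hd : 1 ≤ d) {ι : Type*} (S : Finset ι)
    (y : ι → EuclideanSpace ℝ (Fin d)) {r R : ℝ} (hr : 0 ≤ r) (hR : 0 ≤ R)
    (x : EuclideanSpace ℝ (Fin d))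
    (hdisj : (S : Set ι).PairwiseDisjoint fun i => Metric.ball (y i) r)
    (hsub : ∀ i ∈ S, Metric.ball (y i) r ⊆ Metric.ball x R) :
    (S.card : ℝ) * r ^ d ≤ R ^ d := by
  have : Nonempty (Fin d) := ⟨⟨0, hd⟩⟩
  have hfin : Module.finrank ℝ (EuclideanSpace ℝ (Fin d)) = d := by simp
  let μ : MeasureTheory.Measure (EuclideanSpace ℝ (Fin d)) := MeasureTheory.volume
  have h1 : μ (⋃ i ∈ S, Metric.ball (y i) r) = ∑ i ∈ S, μ (Metric.ball (y i) r) :=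
    MeasureTheory.measure_biUnion_finset hdisj fun i _ => measurableSet_ball
  have h2 : μ (⋃ i ∈ S, Metric.ball (y i) r) ≤ μ (Metric.ball x R) :=
    MeasureTheory.measure_mono (Set.iUnion₂_subset hsub)
  rw [h1] at h2
  simp only [μ.addHaar_ball _ hr, μ.addHaar_ball _ hR, hfin, Finset.sum_const, nsmul_eq_mul] at h2
  rw [← mul_assoc, ENNReal.mul_le_mul_iff_left (Metric.measure_ball_pos μ _ one_pos).ne'
    MeasureTheory.measure_ball_lt_top.ne, ← ENNReal.ofReal_natCast,
    ← ENNReal.ofReal_mul (by positivity)] at h2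
  exact (ENNReal.ofReal_le_ofReal_iff (by positivity)).1 h2

/-! ### Size and separation of the basic sets -/

namespace IsBasicFamily

variable {d : ℕ} {J : Set (EuclideanSpace ℝ (Fin d))} {c : ℕ → ℝ} {n : ℕ → ℕ} {a : ℕ → ℝ}
  {B : (k : ℕ) → Word n k → Set (EuclideanSpace ℝ (Fin d))}

theorem subset_of_mem_descendants (h : IsBasicFamily J c n a B) {k m : ℕ} {σ : Word n k}
    {τ : Word n (k + m)} (hτ : τ ∈ σ.descendants m) : B (k + m) τ ⊆ B k σ := by
  induction m with
  | zero =>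
    obtain rfl : τ = σ := by simpa [Word.descendants] using hτ
    rfl
  | succ m ih =>
    obtain ⟨⟨τ', j⟩, hp, rfl⟩ := Finset.mem_image.1 hτ
    exact (h.subset (k + m) τ' j).trans (ih (Finset.mem_product.1 hp).1)

theorem induction_words (h : IsBasicFamily J c n a B)
    {P : (k : ℕ) → Set (EuclideanSpace ℝ (Fin d)) → Prop} (h0 : P 0 J)
    (hs : ∀ (k : ℕ) (σ : Word n k) (j : Fin (n (k + 1))), P k (B k σ) →
      P (k + 1) (B (k + 1) (σ.append j))) (k : ℕ) (σ : Word n k) : P k (B k σ) := by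
  induction k with
  | zero => rwa [h.root]
  | succ k ih =>
    obtain ⟨τ, j, rfl⟩ := Word.exists_append_eq σ
    exact hs k τ j (ih τ)

theorem isCompact (h : IsBasicFamily J c n a B) (hJ : IsCompact J) (k : ℕ) (σ : Word n k) :
    IsCompact (B k σ) := by
  refine h.induction_words (P := fun _ A => IsCompact A) hJ (fun k σ j hc => ?_) k σ
  obtain ⟨f, hf⟩ := h.similar k σ j
  rw [← hf]
  exact hc.image f.toHomeomorph.continuous

theorem disjoint_interior (h : IsBasicFamily J c n a B) (k : ℕ) {σ τ : Word n k} (hne : σ ≠ τ) :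
    Disjoint (interior (B k σ)) (interior (B k τ)) := by
  induction k with
  | zero => exact absurd (Subsingleton.elim σ τ) hne
  | succ k ih =>
    obtain ⟨σ, i, rfl⟩ := Word.exists_append_eq σ
    obtain ⟨τ, j, rfl⟩ := Word.exists_append_eq τ
    by_cases hst : σ = τ
    · subst hst
      exact h.disjoint k σ i j fun hij => hne (by rw [hij])
    · exact (ih hst).mono (interior_mono (h.subset k σ i)) (interior_mono (h.subset k τ j))

/-- A similarity scales an inscribed ball and the diameter by the same ratio, so the constant found
for `J` serves every word. -/
theorem exists_ball_subset_of_diam (h : IsBasicFamily J c n a B) (hJint : (interior J).Nonempty) :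
    ∃ ρ : ℝ, 0 < ρ ∧ ∀ (k : ℕ) (σ : Word n k),
      ∃ y, Metric.ball y (ρ * Metric.diam (B k σ)) ⊆ B k σ := by
  obtain ⟨x, hx⟩ := hJint
  obtain ⟨ε, hε, hb⟩ := Metric.mem_nhds_iff.1 (mem_interior_iff_mem_nhds.1 hx)
  have hD : 0 ≤ Metric.diam J := Metric.diam_nonneg
  refine ⟨ε / (Metric.diam J + 1), by positivity, ?_⟩
  refine h.induction_words (P := fun _ A => ∃ y, Metric.ball y (_ * Metric.diam A) ⊆ A)
    ⟨x, (Metric.ball_subset_ball ?_).trans hb⟩ (fun k σ j hc => ?_)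
  · rw [div_mul_eq_mul_div, div_le_iff₀ (by positivity)]
    nlinarith
  · obtain ⟨y, hy⟩ := hc
    obtain ⟨f, hf⟩ := h.similar k σ j
    have hr : (0 : ℝ) < Dilation.ratio f := Dilation.ratio_pos f
    refine ⟨f y, fun z hz => ?_⟩
    rw [← hf] at hz ⊢
    refine ⟨f.symm z, hy ?_, f.apply_symm_apply z⟩
    rw [Dilation.diam_image, Metric.mem_ball, ← f.apply_symm_apply z, Dilation.dist_eq] at hz
    rw [Metric.mem_ball]
    refine lt_of_mul_lt_mul_left (hz.trans_eq ?_) hr.le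
    ring

theorem diam_pos (h : IsBasicFamily J c n a B) (hd : 1 ≤ d) (hJ : IsCompact J)
    (hJint : (interior J).Nonempty) (k : ℕ) (σ : Word n k) : 0 < Metric.diam (B k σ) := by
  have : Nonempty (Fin d) := ⟨⟨0, hd⟩⟩
  refine h.induction_words (P := fun _ A => 0 < Metric.diam A) ?_ (fun k σ j hc => ?_) k σ
  · obtain ⟨x, hx⟩ := hJint
    exact Metric.diam_pos (infinite_of_mem_nhds x (mem_interior_iff_mem_nhds.1 hx)).nontrivial
      hJ.isBounded
  · obtain ⟨f, hf⟩ := h.similar k σ j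
    rw [← hf, Dilation.diam_image]
    exact mul_pos (Dilation.ratio_pos f) hc

theorem exists_diam_le (h : IsBasicFamily J c n a B) (hadm : IsAdmissible c n a) (hd : 1 ≤ d)
    (hJ : IsCompact J) (hJint : (interior J).Nonempty) :
    ∃ A : ℝ, 0 < A ∧ ∀ (k : ℕ) (σ : Word n k), Metric.diam (B k σ) ≤ A * delta c k := by
  have hJp : 0 < Metric.diam J := by
    obtain ⟨σ⟩ := hadm.word_nonempty 0
    simpa [h.root] using h.diam_pos hd hJ hJint 0 σ
  have key : ∀ (k : ℕ) (σ : Word n k), Metric.diam (B k σ) ≤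
      Metric.diam J * Real.exp (∑ i ∈ Finset.range k, a (i + 1)) * delta c k := by
    refine h.induction_words (P := fun k A => Metric.diam A ≤
      Metric.diam J * Real.exp (∑ i ∈ Finset.range k, a (i + 1)) * delta c k)
      (by simp [delta_zero]) (fun k σ j hc => ?_)
    have h1 := (div_le_iff₀ (h.diam_pos hd hJ hJint k σ)).1 (h.ratio_le k σ j)
    have h2 : 1 + a (k + 1) ≤ Real.exp (a (k + 1)) := by
      rw [add_comm]; exact Real.add_one_le_exp _
    have hcp := hadm.c_pos (k + 1) (by omega)
    have ha := hadm.a_nonneg (k + 1) (by omega)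
    calc _ ≤ _ := h1
      _ ≤ c (k + 1) * Real.exp (a (k + 1)) *
          (Metric.diam J * Real.exp (∑ i ∈ Finset.range k, a (i + 1)) * delta c k) := by
        gcongr
      _ = _ := by rw [Finset.sum_range_succ, Real.exp_add, delta_succ]; ring
  refine ⟨Metric.diam J * Real.exp (∑' i, a (i + 1)), by positivity, fun k σ =>
    (key k σ).trans ?_⟩
  have := hadm.delta_pos k
  have hs := hadm.a_summable.sum_le_tsum (Finset.range k)
    fun i _ => hadm.a_nonneg (i + 1) (by omega)
  gcongr

/-- The factors `1 - a_k` may be nonpositive for finitely many `k`. Up to level `K` the bound comes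
from finiteness of the set of words and positivity of diameters; beyond it, from `1 - a ≥ exp (-2a)`
for `0 ≤ a < 1/2`. -/
theorem exists_le_diam (h : IsBasicFamily J c n a B) (hadm : IsAdmissible c n a) (hd : 1 ≤ d)
    (hJ : IsCompact J) (hJint : (interior J).Nonempty) :
    ∃ A : ℝ, 0 < A ∧ ∀ (k : ℕ) (σ : Word n k), A * delta c k ≤ Metric.diam (B k σ) := by
  obtain ⟨K, hK⟩ : ∃ K : ℕ, ∀ k, K ≤ k → a (k + 1) < 1 / 2 :=
    Filter.eventually_atTop.1
      (hadm.a_summable.tendsto_atTop_zero.eventually_lt_const (by norm_num))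
  have hfin : ∀ k : ℕ, ∃ A : ℝ, 0 < A ∧ ∀ m ≤ k, ∀ σ : Word n m, A ≤ Metric.diam (B m σ) := by
    have hlev : ∀ m : ℕ, ∃ A : ℝ, 0 < A ∧ ∀ σ : Word n m, A ≤ Metric.diam (B m σ) := by
      intro m
      have := hadm.word_nonempty m
      obtain ⟨τ, hτ⟩ := Finite.exists_min fun σ : Word n m => Metric.diam (B m σ)
      exact ⟨_, h.diam_pos hd hJ hJint m τ, hτ⟩
    intro k
    induction k with
    | zero =>
      obtain ⟨A, hA, hA'⟩ := hlev 0
      refine ⟨A, hA, fun m hm => ?_⟩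
      obtain rfl : m = 0 := by omega
      exact hA'
    | succ k ih =>
      obtain ⟨A, hA, hA'⟩ := hlev (k + 1)
      obtain ⟨A₁, hA₁, hA₁'⟩ := ih
      refine ⟨min A A₁, lt_min hA hA₁, fun m hm σ => ?_⟩
      rcases Nat.le_succ_iff.1 hm with hm | rfl
      · exact (min_le_right _ _).trans (hA₁' m hm σ)
      · exact (min_le_left _ _).trans (hA' σ)
  obtain ⟨A, hA, hA'⟩ := hfin K
  have key : ∀ (k : ℕ) (σ : Word n k),
      A * Real.exp (-2 * ∑ i ∈ Finset.range k, a (i + 1)) * delta c k ≤ Metric.diam (B k σ) := by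
    intro k
    have hexp : ∀ k, Real.exp (-2 * ∑ i ∈ Finset.range k, a (i + 1)) ≤ 1 := fun k =>
      Real.exp_le_one_iff.2 (by
        have := Finset.sum_nonneg fun i (_ : i ∈ Finset.range k) =>
          hadm.a_nonneg (i + 1) (by omega)
        linarith)
    have hsmall : ∀ k ≤ K, ∀ σ : Word n k,
        A * Real.exp (-2 * ∑ i ∈ Finset.range k, a (i + 1)) * delta c k ≤
          Metric.diam (B k σ) := fun k hk σ =>
      (mul_le_of_le_one_right (by positivity) (hadm.delta_le_one k)).trans
        ((mul_le_of_le_one_right hA.le (hexp k)).trans (hA' k hk σ))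
    induction k with
    | zero => exact hsmall 0 (Nat.zero_le K)
    | succ k ih =>
      rcases Nat.lt_or_ge k K with hk | hk
      · exact hsmall (k + 1) hk
      intro σ
      obtain ⟨σ, j, rfl⟩ := Word.exists_append_eq σ
      have h1 := (le_div_iff₀ (h.diam_pos hd hJ hJint k σ)).1 (h.le_ratio k σ j)
      have hcp := hadm.c_pos (k + 1) (by omega)
      have ha := hadm.a_nonneg (k + 1) (by omega)
      have ha' := hK k hk
      have hδ := hadm.delta_pos k
      have h2 : Real.exp (-2 * a (k + 1)) ≤ 1 - a (k + 1) := by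
        have h3 : Real.exp (-2 * a (k + 1)) * Real.exp (2 * a (k + 1)) = 1 := by
          rw [← Real.exp_add]; simp
        have h4 := Real.add_one_le_exp (2 * a (k + 1))
        have h5 := Real.exp_pos (-2 * a (k + 1))
        -- `exp (-2a) (1 + 2a) ≤ 1 ≤ (1 - a) (1 + 2a)`, the last step because `a ≤ 1/2`.
        nlinarith
      calc _ = c (k + 1) * Real.exp (-2 * a (k + 1)) *
            (A * Real.exp (-2 * ∑ i ∈ Finset.range k, a (i + 1)) * delta c k) := by
            rw [Finset.sum_range_succ, mul_add, Real.exp_add, delta_succ]; ring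
        _ ≤ c (k + 1) * (1 - a (k + 1)) * Metric.diam (B k σ) := by
            gcongr
            · nlinarith
            · exact ih σ
        _ ≤ _ := h1
  refine ⟨A * Real.exp (-2 * ∑' i, a (i + 1)), by positivity, fun k σ => le_trans ?_ (key k σ)⟩
  have := hadm.delta_pos k
  have hs := hadm.a_summable.sum_le_tsum (Finset.range k)
    fun i _ => hadm.a_nonneg (i + 1) (by omega)
  gcongr ?_ * ?_ * ?_
  exact Real.exp_le_exp.2 (by linarith)

theorem exists_ball_subset (h : IsBasicFamily J c n a B) (hadm : IsAdmissible c n a) (hd : 1 ≤ d)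
    (hJ : IsCompact J) (hJint : (interior J).Nonempty) :
    ∃ ρ : ℝ, 0 < ρ ∧ ∀ (k : ℕ) (σ : Word n k),
      ∃ y, Metric.ball y (ρ * delta c k) ⊆ B k σ := by
  obtain ⟨A, hA, hA'⟩ := h.exists_le_diam hadm hd hJ hJint
  obtain ⟨ρ, hρ, hb⟩ := h.exists_ball_subset_of_diam hJint
  refine ⟨ρ * A, by positivity, fun k σ => ?_⟩
  obtain ⟨y, hy⟩ := hb k σ
  refine ⟨y, (Metric.ball_subset_ball ?_).trans hy⟩
  rw [mul_assoc]
  exact mul_le_mul_of_nonneg_left (hA' k σ) hρ.le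

/-- A ball of radius comparable to `δ_k` meets boundedly many basic sets of level `k`. -/
theorem exists_card_le (h : IsBasicFamily J c n a B) (hadm : IsAdmissible c n a) (hd : 1 ≤ d)
    (hJ : IsCompact J) (hJint : (interior J).Nonempty) {T : ℝ} (hT : 0 ≤ T) :
    ∃ M : ℕ, ∀ (k : ℕ) (x : EuclideanSpace ℝ (Fin d)) (S : Finset (Word n k)),
      (∀ σ ∈ S, (B k σ ∩ Metric.closedBall x (T * delta c k)).Nonempty) → S.card ≤ M := by
  obtain ⟨A, hA, hA'⟩ := h.exists_diam_le hadm hd hJ hJint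
  obtain ⟨ρ, hρ, hb⟩ := h.exists_ball_subset hadm hd hJ hJint
  choose y hy using hb
  -- Sets of diameter at most `A δ_k` meeting the ball of radius `T δ_k` stay within `(T + A) δ_k`
  -- of `x`; the `+ 1` puts them in an open ball.
  refine ⟨⌊((T + A + 1) / ρ) ^ d⌋₊, fun k x S hS => Nat.le_floor ?_⟩
  have hδ := hadm.delta_pos k
  have := card_mul_pow_le_of_disjoint_balls hd S (y k) (r := ρ * delta c k)
    (R := (T + A + 1) * delta c k) (by positivity) (by positivity) x
    (fun σ _ τ _ hne => (h.disjoint_interior k hne).mono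
      (interior_maximal (hy k σ) Metric.isOpen_ball) (interior_maximal (hy k τ) Metric.isOpen_ball))
    (fun σ hσ z hz => ?_)
  · rw [div_pow, le_div_iff₀ (by positivity)]
    rw [mul_pow, mul_pow, ← mul_assoc] at this
    exact le_of_mul_le_mul_right this (by positivity)
  · obtain ⟨w, hw, hwx⟩ := hS σ hσ
    have h1 := Metric.dist_le_diam_of_mem (h.isCompact hJ k σ).isBounded (hy k σ hz) hw
    have h2 := dist_triangle z w x
    rw [Metric.mem_closedBall] at hwx
    rw [Metric.mem_ball]
    nlinarith [hA' k σ]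

/-- The `c_k` may approach `1`, so decay is not automatic. It is forced by volume: `J` contains at
least `2 ^ k` disjoint balls of radius `ρ δ_k`. This is what makes `l(θ, k)` exist. -/
theorem tendsto_delta (h : IsBasicFamily J c n a B) (hadm : IsAdmissible c n a) (hd : 1 ≤ d)
    (hJ : IsCompact J) (hJint : (interior J).Nonempty) :
    Filter.Tendsto (delta c) Filter.atTop (nhds 0) := by
  obtain ⟨ρ, hρ, hb⟩ := h.exists_ball_subset hadm hd hJ hJint
  obtain ⟨R, hR, hJR⟩ : ∃ R : ℝ, 0 < R ∧ J ⊆ Metric.ball 0 R := by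
    obtain ⟨R, hR⟩ := hJ.isBounded.subset_ball 0
    exact ⟨max R 1, by positivity, hR.trans (Metric.ball_subset_ball (le_max_left _ _))⟩
  choose y hy using hb
  have hsub : ∀ (k : ℕ) (σ : Word n k), B k σ ⊆ J :=
    h.induction_words (P := fun _ A => A ⊆ J) subset_rfl
      fun k σ j hσ => (h.subset k σ j).trans hσ
  have hcard : ∀ k, 2 ^ k ≤ Fintype.card (Word n k) := fun k => by
    rw [Fintype.card_pi]
    simpa using Finset.prod_le_prod' (s := Finset.univ)
      fun (i : Fin k) _ => hadm.two_le (i + 1) (by omega)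
  have hbound : ∀ k : ℕ, delta c k ^ d ≤ (R / ρ) ^ d * (1 / 2) ^ k := fun k => by
    have hδ := hadm.delta_pos k
    have h1 := card_mul_pow_le_of_disjoint_balls hd Finset.univ (y k) (r := ρ * delta c k)
      (R := R) (by positivity) hR.le 0
      (fun σ _ τ _ hne => (h.disjoint_interior k hne).mono
        (interior_maximal (hy k σ) Metric.isOpen_ball)
        (interior_maximal (hy k τ) Metric.isOpen_ball))
      (fun σ _ => (hy k σ).trans ((hsub k σ).trans hJR))
    have h2 : (2 : ℝ) ^ k ≤ (Finset.univ : Finset (Word n k)).card := by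
      exact_mod_cast hcard k
    rw [div_pow, one_div, inv_pow, ← div_eq_mul_inv, div_div, le_div_iff₀ (by positivity)]
    calc _ = 2 ^ k * (ρ * delta c k) ^ d := by ring
      _ ≤ _ := (mul_le_mul_of_nonneg_right h2 (by positivity)).trans h1
  have hpow : Filter.Tendsto (fun k => delta c k ^ d) Filter.atTop (nhds 0) :=
    squeeze_zero (fun k => by have := hadm.delta_pos k; positivity) hbound (by
      simpa using (tendsto_pow_atTop_nhds_zero_of_lt_one (r := (1 / 2 : ℝ))
        (by norm_num) (by norm_num)).const_mul ((R / ρ) ^ d))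
  refine Metric.tendsto_atTop.2 fun ε hε => ?_
  obtain ⟨K, hK⟩ := Filter.eventually_atTop.1 (hpow.eventually_lt_const (pow_pos hε d))
  refine ⟨K, fun k hk => ?_⟩
  rw [Real.dist_0_eq_abs, abs_of_pos (hadm.delta_pos k)]
  exact lt_of_pow_lt_pow_left₀ d hε.le (hK k hk)

end IsBasicFamily

end CantorLike

/-! ### Covering numbers between two scales -/

namespace CantorLike

/-- Balls of radius `H r` are covered by boundedly many balls of radius `r`, uniformly in `r`. -/
theorem exists_finset_cover_closedBall (d : ℕ) (H : ℝ) :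
    ∃ Q : ℕ, ∀ (z : EuclideanSpace ℝ (Fin d)) (r : ℝ), 0 < r →
      ∃ N : Finset (EuclideanSpace ℝ (Fin d)), N.card ≤ Q ∧
        ∀ p ∈ Metric.closedBall z (H * r), ∃ w ∈ N, dist p w ≤ r := by
  classical
  obtain ⟨t, -, ht, hcov⟩ := (isCompact_closedBall (0 : EuclideanSpace ℝ (Fin d))
    H).finite_cover_balls one_pos
  refine ⟨ht.toFinset.card, fun z r hr => ⟨ht.toFinset.image fun w => z + r • w,
    Finset.card_image_le, fun p hp => ?_⟩⟩
  have hp' : r⁻¹ • (p - z) ∈ Metric.closedBall (0 : EuclideanSpace ℝ (Fin d)) H := by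
    rw [mem_closedBall_zero_iff, norm_smul, norm_inv, Real.norm_of_nonneg hr.le,
      ← dist_eq_norm, inv_mul_le_iff₀ hr, mul_comm]
    exact hp
  obtain ⟨w, hw, hpw⟩ := Set.mem_iUnion₂.1 (hcov hp')
  refine ⟨z + r • w, Finset.mem_image_of_mem _ (by simpa using hw), ?_⟩
  have h1 : p - (z + r • w) = r • (r⁻¹ • (p - z) - w) := by
    rw [smul_sub, smul_inv_smul₀ hr.ne']; abel
  rw [dist_eq_norm, h1, norm_smul, Real.norm_of_nonneg hr.le, ← dist_eq_norm]
  exact mul_le_of_le_one_right hr.le (Metric.mem_ball.1 hpw).le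

namespace IsAdmissible

variable {c : ℕ → ℝ} {n : ℕ → ℕ} {a : ℕ → ℝ}

theorem isGreatest_level (h : IsAdmissible c n a)
    (hδ : Filter.Tendsto (delta c) Filter.atTop (nhds 0)) {θ : ℝ} (hθ0 : 0 < θ) (hθ1 : θ < 1)
    {k : ℕ} (hk : 1 ≤ k) : IsGreatest (levelSet c θ k) (level c θ k) ∧ k ≤ level c θ k := by
  have hbdd : BddAbove (levelSet c θ k) := by
    obtain ⟨K, hK⟩ := Filter.eventually_atTop.1
      (hδ.eventually_lt_const (Real.rpow_pos_of_pos (h.delta_pos k) (1 / θ)))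
    exact ⟨K, fun l hl => le_of_not_ge fun hlK => (hK l hlK).not_ge hl.2⟩
  have hmem : k ∈ levelSet c θ k := ⟨hk, by
    simpa using Real.rpow_le_rpow_of_exponent_ge (h.delta_pos k) (h.delta_le_one k)
      ((one_lt_div hθ0).2 hθ1).le⟩
  exact ⟨⟨Nat.sSup_mem ⟨k, hmem⟩ hbdd, fun l hl => le_csSup hbdd hl⟩, le_csSup hbdd hmem⟩

end IsAdmissible

namespace IsBasicFamily

variable {d : ℕ} {J : Set (EuclideanSpace ℝ (Fin d))} {c : ℕ → ℝ} {n : ℕ → ℕ} {a : ℕ → ℝ}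
  {B : (k : ℕ) → Word n k → Set (EuclideanSpace ℝ (Fin d))}

theorem inter_nonempty (h : IsBasicFamily J c n a B) (hadm : IsAdmissible c n a) (hd : 1 ≤ d)
    (hJ : IsCompact J) (hJint : (interior J).Nonempty) (k : ℕ) (σ : Word n k) :
    ((⋂ (k : ℕ) (_ : 1 ≤ k), ⋃ σ : Word n k, B k σ) ∩ B k σ).Nonempty := by
  have hn : ∀ i : ℕ, 0 < n (i + 1) := fun i => by
    have := hadm.two_le (i + 1) (by omega); omega
  -- Always appending the letter `0` gives a decreasing sequence of compact sets inside `B k σ`.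
  let s : (m : ℕ) → Word n (k + m) := fun m =>
    Nat.rec (motive := fun m => Word n (k + m)) σ (fun m τ => τ.append ⟨0, hn (k + m)⟩) m
  obtain ⟨x, hx⟩ := IsCompact.nonempty_iInter_of_sequence_nonempty_isCompact_isClosed
    (fun m => B (k + m) (s m)) (fun m => h.subset (k + m) (s m) _)
    (fun m => Set.nonempty_iff_ne_empty.2 fun he => by
      have := h.diam_pos hd hJ hJint (k + m) (s m)
      rw [he, Metric.diam_empty] at this
      exact this.false)
    (h.isCompact hJ _ _) (fun m => (h.isCompact hJ _ _).isClosed)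
  rw [Set.mem_iInter] at hx
  refine ⟨x, Set.mem_iInter₂.2 fun i _ => Set.mem_iUnion.2 ?_, hx 0⟩
  rcases le_total k i with hki | hik
  · obtain ⟨m, rfl⟩ := Nat.exists_eq_add_of_le hki
    exact ⟨s m, hx m⟩
  · obtain ⟨m, rfl⟩ := Nat.exists_eq_add_of_le hik
    obtain ⟨τ, hτ⟩ := Word.exists_mem_descendants i m σ
    exact ⟨τ, h.subset_of_mem_descendants hτ (hx 0)⟩

theorem exists_covering_le (h : IsBasicFamily J c n a B) (hadm : IsAdmissible c n a)
    (hd : 1 ≤ d) (hJ : IsCompact J) (hJint : (interior J).Nonempty) {T H : ℝ} (hT : 0 ≤ T) :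
    ∃ C : ℕ, ∀ (k m : ℕ) (x : EuclideanSpace ℝ (Fin d)) (R r : ℝ), 1 ≤ k → 0 < r →
      R ≤ T * delta c k → delta c (k + m) ≤ H * r →
      Metric.externalCoveringNumber r.toNNReal
        (Metric.closedBall x R ∩ ⋂ (k : ℕ) (_ : 1 ≤ k), ⋃ σ : Word n k, B k σ) ≤
        (C * ∏ i ∈ Finset.Icc (k + 1) (k + m), n i : ℕ) := by
  classical
  obtain ⟨A, hA, hA'⟩ := h.exists_diam_le hadm hd hJ hJint
  obtain ⟨M, hM⟩ := h.exists_card_le hadm hd hJ hJint hT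
  obtain ⟨Q, hQ⟩ := exists_finset_cover_closedBall d (A * H)
  refine ⟨M * Q, fun k m x R r hk hr hR hδ => ?_⟩
  choose N hNc hN using fun z => hQ z r hr
  have hne : ∀ τ : Word n (k + m), (B (k + m) τ).Nonempty := fun τ =>
    (h.inter_nonempty hadm hd hJ hJint (k + m) τ).mono Set.inter_subset_right
  choose e he using hne
  let S : Finset (Word n k) :=
    Finset.univ.filter fun σ => (B k σ ∩ Metric.closedBall x (T * delta c k)).Nonempty
  let F : Finset (EuclideanSpace ℝ (Fin d)) :=
    S.biUnion fun σ => (σ.descendants m).biUnion fun τ => N (e τ)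
  have hF : F.card ≤ M * Q * ∏ i ∈ Finset.Icc (k + 1) (k + m), n i := by
    refine (Finset.card_biUnion_le_card_mul _ _
      ((∏ i ∈ Finset.Icc (k + 1) (k + m), n i) * Q) fun σ _ => ?_).trans ?_
    · rw [← Word.card_descendants σ m]
      exact Finset.card_biUnion_le_card_mul _ _ _ fun τ _ => hNc _
    · rw [mul_assoc, mul_comm Q]
      exact Nat.mul_le_mul_right _ (hM k x S fun σ hσ => (Finset.mem_filter.1 hσ).2)
  have hcov : Metric.IsCover r.toNNReal
      (Metric.closedBall x R ∩ ⋂ (k : ℕ) (_ : 1 ≤ k), ⋃ σ : Word n k, B k σ)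
      (F : Set (EuclideanSpace ℝ (Fin d))) := by
    rintro p ⟨hpx, hp⟩
    obtain ⟨τ, hτ⟩ := Set.mem_iUnion.1 (Set.mem_iInter₂.1 hp (k + m) (by omega))
    obtain ⟨σ, hσ⟩ := Word.exists_mem_descendants k m τ
    have hσS : σ ∈ S := Finset.mem_filter.2 ⟨Finset.mem_univ _, p,
      h.subset_of_mem_descendants hσ hτ, Metric.closedBall_subset_closedBall hR hpx⟩
    have hpe : p ∈ Metric.closedBall (e τ) (A * H * r) := by
      rw [Metric.mem_closedBall, mul_assoc]
      exact (Metric.dist_le_diam_of_mem (h.isCompact hJ _ τ).isBounded hτ (he τ)).trans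
        ((hA' _ τ).trans (mul_le_mul_of_nonneg_left hδ hA.le))
    obtain ⟨w, hw, hpw⟩ := hN (e τ) p hpe
    refine ⟨w, Finset.mem_coe.2 (Finset.mem_biUnion.2 ⟨σ, hσS, Finset.mem_biUnion.2
      ⟨τ, hσ, hw⟩⟩), ?_⟩
    change edist p w ≤ ENNReal.ofReal r
    rw [edist_dist]
    exact ENNReal.ofReal_le_ofReal hpw
  refine hcov.externalCoveringNumber_le_encard.trans ?_
  rw [Set.encard_coe_eq_coe_finsetCard]
  exact_mod_cast hF

/-- Pigeonhole: each descendant of `σ` contains a point of `E` in the ball, and one covering ball of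
radius at most `T δ_{k+m}` can serve only boundedly many descendants. -/
theorem exists_le_covering (h : IsBasicFamily J c n a B) (hadm : IsAdmissible c n a)
    (hd : 1 ≤ d) (hJ : IsCompact J) (hJint : (interior J).Nonempty) {T : ℝ} (hT : 0 ≤ T) :
    ∃ M : ℕ, ∀ (k m : ℕ) (σ : Word n k) (x : EuclideanSpace ℝ (Fin d)) (R r : ℝ), 0 ≤ r →
      x ∈ B k σ → Metric.diam (B k σ) ≤ R → r ≤ T * delta c (k + m) →
      ((∏ i ∈ Finset.Icc (k + 1) (k + m), n i : ℕ) : ℕ∞) ≤ M *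
        Metric.externalCoveringNumber r.toNNReal
          (Metric.closedBall x R ∩ ⋂ (k : ℕ) (_ : 1 ≤ k), ⋃ σ : Word n k, B k σ) := by
  classical
  obtain ⟨M, hM⟩ := h.exists_card_le hadm hd hJ hJint hT
  -- The `+ 1` keeps the factor nonzero, as needed to move it inside infima whose index may be
  -- empty.
  refine ⟨M + 1, fun k m σ x R r hr hx hR hrT => ?_⟩
  choose e heE he using fun τ : Word n (k + m) => h.inter_nonempty hadm hd hJ hJint (k + m) τ
  rw [Metric.externalCoveringNumber, ENat.mul_iInf_of_ne (by simp)]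
  refine le_iInf fun N => ?_
  rw [ENat.mul_iInf_of_ne (by simp)]
  refine le_iInf fun hN => ?_
  rcases N.finite_or_infinite with hfin | hinf
  swap
  · simp [hinf.encard_eq]
  have hmem : ∀ τ ∈ σ.descendants m, ∃ z ∈ N, dist (e τ) z ≤ r := fun τ hτ => by
    obtain ⟨z, hz, hdz⟩ := hN (x := e τ) ⟨(Metric.dist_le_diam_of_mem (h.isCompact hJ k σ).isBounded
      (h.subset_of_mem_descendants hτ (he τ)) hx).trans hR, heE τ⟩
    refine ⟨z, hz, ?_⟩
    change edist (e τ) z ≤ ENNReal.ofReal r at hdz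
    rwa [edist_dist, ENNReal.ofReal_le_ofReal_iff hr] at hdz
  choose! g hgN hg using hmem
  have hcard := Finset.card_le_mul_card_image_of_maps_to (s := σ.descendants m)
    (t := hfin.toFinset) (f := g) (fun τ hτ => hfin.mem_toFinset.2 (hgN τ hτ)) (M + 1)
    fun z _ => (hM (k + m) z _ fun τ hτ => ?_).trans (Nat.le_succ M)
  · rw [Word.card_descendants] at hcard
    rw [hfin.encard_eq_coe_toFinset_card]
    exact_mod_cast hcard
  · obtain ⟨hτσ, rfl⟩ := Finset.mem_filter.1 hτ
    exact ⟨e τ, he τ, (hg τ hτσ).trans hrT⟩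

/-! ### The two bounds for the spectrum -/

theorem assouadSpectrum_le (h : IsBasicFamily J c n a B) (hadm : IsAdmissible c n a)
    (hd : 1 ≤ d) (hJ : IsCompact J) (hJint : (interior J).Nonempty) {θ : ℝ} (hθ0 : 0 < θ)
    (hθ1 : θ < 1) {s : ℝ} (hs : 0 ≤ s) {K : ℕ}
    (hK : ∀ k, K ≤ k → 1 ≤ k → ((∏ i ∈ Finset.Icc (k + 1) (level c θ k), n i : ℕ) : ℝ) ≤
      delta c k ^ ((1 - 1 / θ) * s)) :
    assouadSpectrum θ (⋂ (k : ℕ) (_ : 1 ≤ k), ⋃ σ : Word n k, B k σ) ≤ (s : EReal) := by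
  set κ : ℝ := ⨅ k : ℕ, c (k + 1) with hκ
  have hκ0 : 0 < κ := hadm.c_inf_pos
  have hlim := h.tendsto_delta hadm hd hJ hJint
  have hexp : (1 - 1 / θ) * s ≤ 0 :=
    mul_nonpos_of_nonpos_of_nonneg (sub_nonpos.2 ((one_le_div hθ0).2 hθ1.le)) hs
  obtain ⟨C, hC⟩ := h.exists_covering_le hadm hd hJ hJint (T := κ⁻¹) (H := κ⁻¹)
    (inv_nonneg.2 hκ0.le)
  -- Taking `b = δ_K` forces the level chosen for `R` past `K`; the power of `κ` pays for replacing
  -- `δ_k` by `κ R` under a nonpositive exponent.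
  refine sInf_le ⟨s, ⟨hs, delta c K, (C + 1) * κ ^ ((1 - 1 / θ) * s), hadm.delta_pos K,
    by positivity, fun R hR0 hRK x _ => ?_⟩, rfl⟩
  have hex : ∃ k, delta c k ≤ R := (hlim.eventually_le_const hR0).exists
  -- The first level with `δ_k ≤ R`, so that `κ R ≤ δ_k ≤ R`.
  obtain ⟨k, hkR, hkmin⟩ : ∃ k, delta c k ≤ R ∧ ∀ m < k, R < delta c m :=
    ⟨Nat.find hex, Nat.find_spec hex, fun m hm => not_le.1 (Nat.find_min hex hm)⟩
  have hKk : K < k := lt_of_not_ge fun hle => by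
    have := hadm.delta_antitone hle
    linarith
  obtain ⟨j, rfl⟩ : ∃ j, k = j + 1 := ⟨k - 1, by omega⟩
  have hkR' : κ * R ≤ delta c (j + 1) :=
    (mul_le_mul_of_nonneg_left (hkmin j (by omega)).le hκ0.le).trans (hadm.iInf_mul_delta_le j)
  obtain ⟨hl, hkl⟩ := hadm.isGreatest_level hlim hθ0 hθ1 (k := j + 1) (by omega)
  have hr : 0 < R ^ (1 / θ) := Real.rpow_pos_of_pos hR0 _
  have hnext : delta c (level c θ (j + 1) + 1) < R ^ (1 / θ) := by
    refine lt_of_not_ge fun hle => ?_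
    have := hl.2 (show level c θ (j + 1) + 1 ∈ levelSet c θ (j + 1) from ⟨by omega,
      (Real.rpow_le_rpow (hadm.delta_pos _).le hkR (by positivity)).trans hle⟩)
    omega
  obtain ⟨m, hm⟩ := Nat.exists_eq_add_of_le hkl
  have hcov := hC (j + 1) m x R (R ^ (1 / θ)) (by omega) hr
    ((le_inv_mul_iff₀ hκ0).2 hkR') ((le_inv_mul_iff₀ hκ0).2 (by
      rw [← hm]; exact (hadm.iInf_mul_delta_le _).trans hnext.le))
  have hprod := hK (j + 1) hKk.le (by omega)
  rw [hm] at hprod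
  have hcov' := ENat.toENNReal_le.2 hcov
  refine hcov'.trans ?_
  rw [ENat.toENNReal_coe, ← ENNReal.ofReal_natCast]
  refine ENNReal.ofReal_le_ofReal ?_
  rw [← Real.rpow_one_sub' hR0.le (by
      have := (one_lt_div hθ0).2 hθ1; linarith), ← Real.rpow_mul hR0.le, mul_assoc,
    ← Real.mul_rpow hκ0.le hR0.le]
  push_cast at hprod ⊢
  have h1 := hprod.trans (Real.rpow_le_rpow_of_nonpos (by positivity) hkR' hexp)
  exact mul_le_mul (by linarith) h1 (Finset.prod_nonneg fun _ _ => by positivity) (by positivity)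

theorem exists_prod_le (h : IsBasicFamily J c n a B) (hadm : IsAdmissible c n a)
    (hd : 1 ≤ d) (hJ : IsCompact J) (hJint : (interior J).Nonempty) {θ : ℝ} (hθ0 : 0 < θ)
    (hθ1 : θ < 1) {s b C : ℝ} (hb : 0 < b) (hC : 0 < C)
    (hcov : ∀ R : ℝ, 0 < R → R < b → ∀ x ∈ ⋂ (k : ℕ) (_ : 1 ≤ k), ⋃ σ : Word n k, B k σ,
      ((Metric.externalCoveringNumber (R ^ (1 / θ)).toNNReal
          (Metric.closedBall x R ∩ ⋂ (k : ℕ) (_ : 1 ≤ k), ⋃ σ : Word n k, B k σ) : ℕ∞) : ℝ≥0∞)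
        ≤ ENNReal.ofReal (C * (R / R ^ (1 / θ)) ^ s)) :
    ∃ D : ℝ, 0 < D ∧ ∀ᶠ k in Filter.atTop,
      ((∏ i ∈ Finset.Icc (k + 1) (level c θ k), n i : ℕ) : ℝ) ≤
        D * delta c k ^ ((1 - 1 / θ) * s) := by
  have hlim := h.tendsto_delta hadm hd hJ hJint
  obtain ⟨A, hA, hA'⟩ := h.exists_diam_le hadm hd hJ hJint
  -- With `R = A δ_k`, the small radius is `A ^ (1 / θ) δ_k ^ (1 / θ) ≤ A ^ (1 / θ) δ_l` for `l =
  -- l(θ, k)`.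
  obtain ⟨M, hM⟩ := h.exists_le_covering hadm hd hJ hJint (T := A ^ (1 / θ)) (by positivity)
  refine ⟨(M + 1) * C * A ^ ((1 - 1 / θ) * s), by positivity, ?_⟩
  have hev : ∀ᶠ k in Filter.atTop, A * delta c k < b := by
    have := hlim.const_mul A
    rw [mul_zero] at this
    exact this.eventually_lt_const hb
  filter_upwards [hev, Filter.eventually_ge_atTop 1] with k hkb hk
  have hδ := hadm.delta_pos k
  obtain ⟨hl, hkl⟩ := hadm.isGreatest_level hlim hθ0 hθ1 hk
  obtain ⟨m, hm⟩ := Nat.exists_eq_add_of_le hkl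
  obtain ⟨σ⟩ := hadm.word_nonempty k
  obtain ⟨x, hxE, hx⟩ := h.inter_nonempty hadm hd hJ hJint k σ
  have hR : 0 < A * delta c k := by positivity
  have h1 := hM k m σ x (A * delta c k) ((A * delta c k) ^ (1 / θ)) (by positivity) hx (hA' k σ)
    (by
      rw [Real.mul_rpow hA.le hδ.le, ← hm]
      exact mul_le_mul_of_nonneg_left hl.1.2 (by positivity))
  have h2 := ENat.toENNReal_le.2 h1
  rw [ENat.toENNReal_mul, ENat.toENNReal_coe, ENat.toENNReal_coe] at h2
  have h3 := h2.trans (mul_le_mul_right (hcov _ hR hkb x hxE) _)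
  rw [← ENNReal.ofReal_natCast, ← ENNReal.ofReal_natCast, ← ENNReal.ofReal_mul (by positivity),
    ENNReal.ofReal_le_ofReal_iff (by positivity), ← Real.rpow_one_sub' hR.le (by
      have := (one_lt_div hθ0).2 hθ1; linarith), ← Real.rpow_mul hR.le,
    Real.mul_rpow hA.le hδ.le] at h3
  rw [hm]
  refine h3.trans ?_
  rw [← mul_assoc, ← mul_assoc]
  gcongr
  simp

end IsBasicFamily

end CantorLike

/-! ### Passage to logarithms -/

theorem theorem3p3 (d : ℕ) (hd : 1 ≤ d) (J : Set (EuclideanSpace ℝ (Fin d)))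
    (hJ : IsCompact J) (hJint : (interior J).Nonempty)
    (c : ℕ → ℝ) (n : ℕ → ℕ) (a : ℕ → ℝ) (hadm : CantorLike.IsAdmissible c n a)
    (E : Set (EuclideanSpace ℝ (Fin d))) (hE : E ∈ CantorLike.cantorLikeSets J c n a)
    (θ : ℝ) (hθ0 : 0 < θ) (hθ1 : θ < 1) :
    (∀ k : ℕ, 1 ≤ k → IsGreatest (CantorLike.levelSet c θ k) (CantorLike.level c θ k)) ∧
    CantorLike.assouadSpectrum θ E =
      Filter.limsup
        (fun k : ℕ =>
          ((Real.log ((∏ i ∈ Finset.Icc (k + 1) (CantorLike.level c θ k), n i : ℕ) : ℝ) /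
            ((1 - 1 / θ) * Real.log (CantorLike.delta c k)) : ℝ) : EReal))
        Filter.atTop := by
  obtain ⟨B, hB, rfl⟩ := hE
  have hlim := hB.tendsto_delta hadm hd hJ hJint
  have hθ : 1 - 1 / θ < 0 := sub_neg.2 ((one_lt_div hθ0).2 hθ1)
  have hL : ∀ k, 1 ≤ k → 0 < (1 - 1 / θ) * Real.log (CantorLike.delta c k) := fun k hk =>
    mul_pos_of_neg_of_neg hθ (Real.log_neg (hadm.delta_pos k) (hadm.delta_lt_one hk))
  have hP : ∀ k, (1 : ℝ) ≤ (∏ i ∈ Finset.Icc (k + 1) (CantorLike.level c θ k), n i : ℕ) :=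
    fun k => by
      exact_mod_cast Finset.one_le_prod' fun i hi =>
        one_le_two.trans (hadm.two_le i (by have := (Finset.mem_Icc.1 hi).1; omega))
  refine ⟨fun k hk => (hadm.isGreatest_level hlim hθ0 hθ1 hk).1, le_antisymm ?_ ?_⟩
  · refine EReal.le_of_forall_lt_iff_le.1 fun s hs => ?_
    obtain ⟨K, hK⟩ := Filter.eventually_atTop.1 (Filter.eventually_lt_of_limsup_lt hs)
    have hbound : ∀ k, K ≤ k → 1 ≤ k →
        Real.log ((∏ i ∈ Finset.Icc (k + 1) (CantorLike.level c θ k), n i : ℕ) : ℝ) <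
          s * ((1 - 1 / θ) * Real.log (CantorLike.delta c k)) := fun k hk hk1 =>
      (div_lt_iff₀ (hL k hk1)).1 (EReal.coe_lt_coe_iff.1 (hK k hk))
    -- Competing exponents must be nonnegative; this holds since the products are at least `1`.
    have hs0 : 0 ≤ s := by
      have h1 := hbound (max K 1) (le_max_left _ _) (le_max_right _ _)
      have h2 := (Real.log_nonneg (hP (max K 1))).trans_lt h1
      exact (pos_of_mul_pos_left h2 (hL _ (le_max_right _ _)).le).le
    refine hB.assouadSpectrum_le hadm hd hJ hJint hθ0 hθ1 hs0 (K := K) fun k hk hk1 => ?_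
    rw [Real.rpow_def_of_pos (hadm.delta_pos k)]
    refine (Real.log_le_iff_le_exp (one_pos.trans_le (hP k))).1 ((hbound k hk hk1).le.trans_eq ?_)
    ring
  · refine le_sInf ?_
    rintro _ ⟨s, ⟨-, b, C, hb, hC, hcov⟩, rfl⟩
    obtain ⟨D, hD, hDP⟩ := hB.exists_prod_le hadm hd hJ hJint hθ0 hθ1 hb hC hcov
    refine EReal.le_of_forall_lt_iff_le.1 fun t ht => ?_
    have hst : s < t := EReal.coe_lt_coe_iff.1 ht
    have hlog : Filter.Tendsto (fun k => (1 - 1 / θ) * Real.log (CantorLike.delta c k))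
        Filter.atTop Filter.atTop :=
      (Real.tendsto_log_nhdsGT_zero.comp (tendsto_nhdsWithin_iff.2
        ⟨hlim, Filter.Eventually.of_forall hadm.delta_pos⟩)).const_mul_atBot_of_neg hθ
    refine Filter.limsup_le_of_le (h := ?_)
    -- Once the denominator exceeds `log D / (t - s)`, the constant `D` is absorbed by raising `s`
    -- to `t`.
    filter_upwards [hDP, Filter.eventually_ge_atTop 1,
      hlog.eventually_ge_atTop (Real.log D / (t - s))] with k hk hk1 hkD
    refine EReal.coe_le_coe_iff.2 ((div_le_iff₀ (hL k hk1)).2 ?_)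
    have h1 := Real.log_le_log (one_pos.trans_le (hP k)) hk
    have hδ := hadm.delta_pos k
    rw [Real.log_mul hD.ne' (by positivity), Real.log_rpow hδ] at h1
    rw [div_le_iff₀ (sub_pos.2 hst)] at hkD
    linarith
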